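/- Let $G\rightrightarrows Q$ be a Lie groupoid (finite-dimensional smooth manifolds) with source $\alpha$, target $\beta$ (submersions), identity section $\epsilon$, inversion $i$ and multiplication $m(g,h)=gh$ on $G_2=\{(g,h)\in G\times G\mid\beta(g)=\alpha(h)\}$. Let $A_qG=\ker T_{\epsilon(q)}\alpha$, let $\ell_g:\alpha^{-1}(\beta(g))\to\alpha^{-1}(\alpha(g))$, $\ell_g(x)=gx$, and let $r_g\circ i:\alpha^{-1}(\alpha(g))\to\beta^{-1}(\beta(g))$, $(r_g\circ i)(x)=x^{-1}g$. Let $$\mathcal P^\alpha G=\{(g,h,r)\in G^3\mid\alpha(g)=\alpha(h),\ \beta(h)=\alpha(r)\},$$ a groupoid over $G$ with source $(g,h,r)\mapsto g$ and target $(g,h,r)\mapsto r$, whose Lie algebroid has the fibres $A_g(\mathcal P^\alpha G)=\{(a,Y)\in A_{\alpha(g)}G\times T_gG\mid T\alpha(Y)=T\beta(a)\}$, and let $i_{G_2}:G_2\to\mathcal P^\alpha G$, $(g,h)\mapsto(g,g,h)$. The source and target $\tilde\alpha,\tilde\beta:T^*(\mathcal P^\alpha G)\to A^*(\mathcal P^\alpha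 G)$ of the cotangent groupoid are given, for $\mu\in T^*_{(g,h,r)}(\mathcal P^\alpha G)$, by $$\langle\tilde\alpha(\mu),(a,Y)\rangle=\langle\mu,(-Y,-T(r_h\circ i)a,0)\rangle,\qquad(a,Y)\in A_g(\mathcal P^\alpha G),$$ $$\langle\tilde\beta(\mu),(a,Y)\rangle=\langle\mu,(0,T\ell_h a,Y)\rangle,\qquad(a,Y)\in A_r(\mathcal P^\alpha G).$$ Let $L_d:G_2\to\mathbb R$ be smooth and let $\Sigma_{L_d}=\{\mu\in T^*(\mathcal P^\alpha G)\mid i_{G_2}^*\mu=dL_d\}$ (the base point of $\mu$ being in $i_{G_2}(G_2)$). A sequence $\gamma_1,\dots,\gamma_{N-1}$ in $T^*(\mathcal P^\alpha G)$ satisfies the second-order dynamics on $\Sigma_{L_d}$ if all $\gamma_k\in\Sigma_{L_d}$ and $\tilde\alpha(\gamma_k)=\tilde\beta(\gamma_{k-1})$ for $k=2,\dots,N-1$. Let $D_1L_d(g,h)\in T_g^*G$ and $D_2L_d(g,h)\in T_h^*G$ be any covectors with $dL_d(g,h)(u,v)=\langle D_1L_d(g,h),u\rangle+\langle D_2L_d(g,h),v\rangle$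 for all $(u,v)\in T_{(g,h)}G_2=\{(u,v)\in T_gG\times T_hG\mid T\beta(u)=T\alpha(v)\}$ (for instance the partial differentials of a smooth local extension of $L_d$ to $G\times G$). Theorem. Let $g_1,\dots,g_N\in G$ with $(g_k,g_{k+1})\in G_2$ for $k=1,\dots,N-1$. There are $\gamma_k\in T^*_{i_{G_2}(g_k,g_{k+1})}(\mathcal P^\alpha G)$, $k=1,\dots,N-1$, such that $\gamma_1,\dots,\gamma_{N-1}$ satisfies the second-order dynamics on $\Sigma_{L_d}$ if and only if $g_1,\dots,g_N$ satisfies the discrete second-order Euler–Lagrange equations $$\ell_{g_k}^*\bigl(D_1L_d(g_k,g_{k+1})+D_2L_d(g_{k-1},g_k)\bigr)+(r_{g_{k+1}}\circ i)^*\bigl(D_1L_d(g_{k+1},g_{k+2})+D_2L_d(g_k,g_{k+1})\bigr)=0$$ on $A_{\beta(g_k)}G$ for $k=2,\dots,N-2$. -/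

import Mathlib

open Set Topology
open scoped Manifold ContDiff

noncomputable section

namespace SecondOrderGroupoid

/-! ### Derivatives along an equalizer of two maps

A function on a submanifold `S` of a manifold `M` is differentiated with `mfderivWithin`. The lemmas
of this section say that for `S = {y | Φ y = Ψ y}`, with `Φ` and `Ψ` transversal, a derivative within
`S` is uniquely determined on the tangent space `{v | TΦ v = TΨ v}` of `S`. -/

section Equalizer

theorem mem_tangentConeAt_level {E F : Type*} [NormedAddCommGroup E] [NormedSpace ℝ E]
    [FiniteDimensional ℝ E] [NormedAddCommGroup F] [NormedSpace ℝ F] [FiniteDimensional ℝ F]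
    {f : E → F} {f' : E →L[ℝ] F} {a : E} (hf : HasStrictFDerivAt f f' a)
    (hs : Function.Surjective f') {v : E} (hv : f' v = 0) :
    v ∈ tangentConeAt ℝ {y | f y = f a} a := by
  have : CompleteSpace E := FiniteDimensional.complete ℝ E
  have hr : f'.range = ⊤ := LinearMap.range_eq_top.2 hs
  have h1 := (hf.to_implicitFunction hr).hasFDerivAt
  have h2 := hf.map_implicitFunction_eq hr
  have h3 : {z : f'.ker | f (hf.implicitFunction f f' hr (f a) z) = f a} ∈ 𝓝 (0 : f'.ker) := by
    have hc : ContinuousAt (fun z : f'.ker => ((f a, z) : F × f'.ker)) 0 := by fun_prop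
    exact hc.eventually h2
  have h4 : (⟨v, hv⟩ : f'.ker) ∈
      tangentConeAt ℝ {z : f'.ker | f (hf.implicitFunction f f' hr (f a) z) = f a} 0 := by
    rw [tangentConeAt_of_mem_nhds h3]; trivial
  have h5 := h1.hasFDerivWithinAt.mapsTo_tangent_cone (s := {z : f'.ker |
    f (hf.implicitFunction f f' hr (f a) z) = f a}) h4
  rw [hf.implicitFunction_apply_image hr] at h5
  refine tangentConeAt_mono ?_ h5
  rintro _ ⟨z, hz, rfl⟩
  exact hz

variable {E F V : Type*} [NormedAddCommGroup E] [NormedSpace ℝ E] [FiniteDimensional ℝ E]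
  [NormedAddCommGroup F] [NormedSpace ℝ F] [FiniteDimensional ℝ F]
  [NormedAddCommGroup V] [NormedSpace ℝ V]
  {H : Type*} [TopologicalSpace H] {I : ModelWithCorners ℝ E H} [I.Boundaryless]
  {M N W : Type*} [TopologicalSpace M] [ChartedSpace H M]
  [TopologicalSpace N] [ChartedSpace F N] [TopologicalSpace W] [ChartedSpace V W]

theorem hasMFDerivWithinAt_unique_equalizer [IsManifold I ∞ M] [IsManifold 𝓘(ℝ, F) ∞ N]
    {Φ Ψ : M → N} {x : M} (hΦ : ContMDiffAt I 𝓘(ℝ, F) ∞ Φ x)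
    (hΨ : ContMDiffAt I 𝓘(ℝ, F) ∞ Ψ x) (hx : Φ x = Ψ x)
    {A B : E →L[ℝ] F} (hA : HasMFDerivAt I 𝓘(ℝ, F) Φ x A) (hB : HasMFDerivAt I 𝓘(ℝ, F) Ψ x B)
    (hs : Function.Surjective (A - B))
    {f : M → W} {f₁ f₂ : E →L[ℝ] V}
    (h₁ : HasMFDerivWithinAt I 𝓘(ℝ, V) f {y | Φ y = Ψ y} x f₁)
    (h₂ : HasMFDerivWithinAt I 𝓘(ℝ, V) f {y | Φ y = Ψ y} x f₂) {v : E}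
    (hv : A v = B v) : f₁ v = f₂ v := by
  have h₁' : HasFDerivWithinAt (𝕜 := ℝ) (E := E) (F := V) (writtenInExtChartAt I 𝓘(ℝ, V) x f) f₁
    ((extChartAt I x).symm ⁻¹' {y | Φ y = Ψ y} ∩ range I) (extChartAt I x x) := h₁.2
  have h₂' : HasFDerivWithinAt (𝕜 := ℝ) (E := E) (F := V) (writtenInExtChartAt I 𝓘(ℝ, V) x f) f₂
    ((extChartAt I x).symm ⁻¹' {y | Φ y = Ψ y} ∩ range I) (extChartAt I x x) := h₂.2
  refine h₁'.unique_on h₂' ?_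
  have key : ∀ {Θ : M → N} {C : E →L[ℝ] F}, ContMDiffAt I 𝓘(ℝ, F) ∞ Θ x →
      HasMFDerivAt I 𝓘(ℝ, F) Θ x C →
      HasStrictFDerivAt (fun y => extChartAt 𝓘(ℝ, F) (Θ x) (Θ ((extChartAt I x).symm y)))
        C (extChartAt I x x) := by
    intro Θ C hΘ hC
    have hc := (contMDiffAt_iff.1 hΘ).2
    rw [I.range_eq_univ, contDiffWithinAt_univ] at hc
    have h : HasFDerivWithinAt (fun y => extChartAt 𝓘(ℝ, F) (Θ x) (Θ ((extChartAt I x).symm y)))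
        C univ (extChartAt I x x) := by
      rw [← I.range_eq_univ]; exact hC.2
    exact hc.hasStrictFDerivAt' (hasFDerivWithinAt_univ.1 h) (by simp)
  have k1 := key hΦ hA
  have k2 := key hΨ hB
  rw [← hx] at k2
  have k3 := k1.sub k2
  have k4 := mem_tangentConeAt_level k3 hs (v := v) (sub_eq_zero.2 hv)
  set c := extChartAt I x with hc
  set d := extChartAt 𝓘(ℝ, F) (Φ x) with hd
  have hcx : c.symm (c x) = x := extChartAt_to_inv x
  have hcont : ContinuousAt c.symm (c x) := continuousAt_extChartAt_symm x
  have hU : {y | Φ (c.symm y) ∈ d.source ∧ Ψ (c.symm y) ∈ d.source} ∈ 𝓝 (c x) := by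
    refine Filter.inter_mem ?_ ?_
    · have : ContinuousAt (fun y => Φ (c.symm y)) (c x) :=
        ContinuousAt.comp (by rw [hcx]; exact hΦ.continuousAt) hcont
      refine this.preimage_mem_nhds ?_
      rw [hcx]; exact extChartAt_source_mem_nhds _
    · have : ContinuousAt (fun y => Ψ (c.symm y)) (c x) :=
        ContinuousAt.comp (by rw [hcx]; exact hΨ.continuousAt) hcont
      refine this.preimage_mem_nhds ?_
      rw [hcx, ← hx]; exact extChartAt_source_mem_nhds _
  have k5 : v ∈ tangentConeAt ℝ ({y : E | d (Φ (c.symm y)) - d (Ψ (c.symm y)) =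
      d (Φ (c.symm (c x))) - d (Ψ (c.symm (c x)))} ∩
      {y : E | Φ (c.symm y) ∈ d.source ∧ Ψ (c.symm y) ∈ d.source}) (c x) :=
    (tangentConeAt_inter_nhds (𝕜 := ℝ) (E := E) hU).symm ▸ k4
  refine tangentConeAt_mono ?_ k5
  rintro y ⟨hy, hy1, hy2⟩
  refine ⟨?_, by rw [I.range_eq_univ]; trivial⟩
  change Φ (c.symm y) = Ψ (c.symm y)
  refine d.injOn hy1 hy2 ?_
  have : d (Φ (c.symm y)) - d (Ψ (c.symm y)) = d (Φ (c.symm (c x))) - d (Ψ (c.symm (c x))) := hy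
  rw [hcx, ← hx, sub_self] at this
  exact sub_eq_zero.1 this

end Equalizer

/-! ### Lie groupoids -/

/-- A Lie groupoid `G ⇉ Q`. The partial multiplication is given by a total function `mul`, of which
only the values on composable pairs (`tgt g = src h`) matter. A smooth map with surjective
differentials is a submersion; smoothness of `mul` on the submanifold of composable pairs
is `ContMDiffOn`. -/
structure LieGroupoid (E F : Type*) [NormedAddCommGroup E] [NormedSpace ℝ E]
    [NormedAddCommGroup F] [NormedSpace ℝ F] (G Q : Type*) [TopologicalSpace G] [ChartedSpace E G]
    [TopologicalSpace Q] [ChartedSpace F Q] where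
  /-- the source map `α` -/
  src : G → Q
  /-- the target map `β` -/
  tgt : G → Q
  /-- the identity section `ε` -/
  one : Q → G
  /-- the inversion `i` -/
  inv : G → G
  /-- the multiplication `m` -/
  mul : G → G → G
  src_mul : ∀ g h, tgt g = src h → src (mul g h) = src g
  tgt_mul : ∀ g h, tgt g = src h → tgt (mul g h) = tgt h
  mul_assoc : ∀ g h k, tgt g = src h → tgt h = src k → mul (mul g h) k = mul g (mul h k)
  src_one : ∀ q, src (one q) = q
  tgt_one : ∀ q, tgt (one q) = q
  one_mul : ∀ g, mul (one (src g)) g = g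
  mul_one : ∀ g, mul g (one (tgt g)) = g
  src_inv : ∀ g, src (inv g) = tgt g
  tgt_inv : ∀ g, tgt (inv g) = src g
  mul_inv : ∀ g, mul g (inv g) = one (src g)
  inv_mul : ∀ g, mul (inv g) g = one (tgt g)
  smooth_src : ContMDiff 𝓘(ℝ, E) 𝓘(ℝ, F) ∞ src
  smooth_tgt : ContMDiff 𝓘(ℝ, E) 𝓘(ℝ, F) ∞ tgt
  submersion_src : ∀ g, Function.Surjective (mfderiv 𝓘(ℝ, E) 𝓘(ℝ, F) src g)
  submersion_tgt : ∀ g, Function.Surjective (mfderiv 𝓘(ℝ, E) 𝓘(ℝ, F) tgt g)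
  smooth_one : ContMDiff 𝓘(ℝ, F) 𝓘(ℝ, E) ∞ one
  smooth_inv : ContMDiff 𝓘(ℝ, E) 𝓘(ℝ, E) ∞ inv
  smooth_mul : ContMDiffOn (𝓘(ℝ, E).prod 𝓘(ℝ, E)) 𝓘(ℝ, E) ∞ (fun p : G × G => mul p.1 p.2)
    {p | tgt p.1 = src p.2}

namespace LieGroupoid

variable {E F : Type*} [NormedAddCommGroup E] [NormedSpace ℝ E] [NormedAddCommGroup F]
  [NormedSpace ℝ F] {G Q : Type*} [TopologicalSpace G] [ChartedSpace E G]
  [TopologicalSpace Q] [ChartedSpace F Q] (𝒢 : LieGroupoid E F G Q)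

/-! Tangent spaces `T_g G` and `T_q Q` are, by definition in Mathlib, copies of the model spaces `E`
and `F`, and a tangent vector to a product of copies of `G` is an element of a product of
copies of `E`. -/

/-- The differential `T_g α`. -/
def dsrc (g : G) : E →L[ℝ] F := mfderiv 𝓘(ℝ, E) 𝓘(ℝ, F) 𝒢.src g

/-- The differential `T_g β`. -/
def dtgt (g : G) : E →L[ℝ] F := mfderiv 𝓘(ℝ, E) 𝓘(ℝ, F) 𝒢.tgt g

/-- The fibre `A_q G = ker T_{ε(q)} α` of the Lie algebroid of `G`, a subspace of `T_{ε(q)} G`. -/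
def algebroid (q : Q) : Submodule ℝ E := LinearMap.ker (𝒢.dsrc (𝒢.one q)).toLinearMap

/-- The tangent map `T_{ε(β(g))} ℓ_g` of left translation `ℓ_g(x) = g x`, which is defined on the
fibre `α⁻¹(β(g))`; it is used on the tangent space `A_{β(g)} G` of this fibre only. -/
def dLeft (g : G) : E →L[ℝ] E :=
  mfderivWithin 𝓘(ℝ, E) 𝓘(ℝ, E) (fun x => 𝒢.mul g x) {x | 𝒢.src x = 𝒢.tgt g} (𝒢.one (𝒢.tgt g))

/-- The tangent map `T_{ε(α(g))} (r_g ∘ i)` of `x ↦ x⁻¹ g`, which is defined on the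
fibre `α⁻¹(α(g))`; it is used on the tangent space `A_{α(g)} G` of this fibre only. -/
def dRightInv (g : G) : E →L[ℝ] E :=
  mfderivWithin 𝓘(ℝ, E) 𝓘(ℝ, E) (fun x => 𝒢.mul (𝒢.inv x) g) {x | 𝒢.src x = 𝒢.src g}
    (𝒢.one (𝒢.src g))

/-! ### Composable pairs and second-order Lagrangians -/

/-- The set `G₂` of composable pairs. -/
def composable : Set (G × G) := {p | 𝒢.tgt p.1 = 𝒢.src p.2}

/-- The tangent space `T_{(g,h)} G₂ = {(u, v) | Tβ u = Tα v}`. -/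
def tangentComposable (p : 𝒢.composable) : Submodule ℝ (E × E) where
  carrier := {w | 𝒢.dtgt p.1.1 w.1 = 𝒢.dsrc p.1.2 w.2}
  add_mem' := by
    intro a b ha hb
    simp only [mem_ofPred_eq, Prod.fst_add, Prod.snd_add, map_add] at *
    rw [ha, hb]
  zero_mem' := by simp
  smul_mem' := by
    intro c a ha
    simp only [mem_ofPred_eq, Prod.smul_fst, Prod.smul_snd, map_smul] at *
    rw [ha]

/-- Extension by zero of a function on `G₂` to `G × G`; only the values on `G₂` matter. -/
def extendZero (L : 𝒢.composable → ℝ) : G × G → ℝ := Function.extend Subtype.val L 0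

/-- Smoothness of a function on the submanifold `G₂` of `G × G`. -/
def IsSmooth (L : 𝒢.composable → ℝ) : Prop :=
  ContMDiffOn (𝓘(ℝ, E).prod 𝓘(ℝ, E)) 𝓘(ℝ, ℝ) ∞ (𝒢.extendZero L) 𝒢.composable

/-- The differential `dL` at a point of `G₂`, a covector on `T_{(g,h)} G₂`. -/
def differential (L : 𝒢.composable → ℝ) (p : 𝒢.composable) :
    Module.Dual ℝ (𝒢.tangentComposable p) :=
  (mfderivWithin (𝓘(ℝ, E).prod 𝓘(ℝ, E)) 𝓘(ℝ, ℝ) (𝒢.extendZero L) 𝒢.composable p.1 :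
    E × E →L[ℝ] ℝ).toLinearMap.domRestrict (𝒢.tangentComposable p)

/-- `D₁` and `D₂` are partial differentials of `L : G₂ → ℝ`: covectors
`D₁ g h ∈ T*_g G` and `D₂ g h ∈ T*_h G` such that `dL(g,h) (u, v) = D₁ g h u + D₂ g h v` for all
`(u, v)` tangent to `G₂` at `(g, h)`. (Unless `G₂ = G × G`, such a pair is not unique; the partial
differentials of any smooth extension of `L` to a neighbourhood in `G × G` are one.) -/
def IsPartialDifferentials (L : 𝒢.composable → ℝ) (D₁ D₂ : G → G → (E →L[ℝ] ℝ)) : Prop :=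
  ∀ (p : 𝒢.composable) (w : 𝒢.tangentComposable p),
    𝒢.differential L p w = D₁ p.1.1 p.1.2 w.1.1 + D₂ p.1.1 p.1.2 w.1.2

/-- Partial differentials exist. -/
theorem exists_isPartialDifferentials (L : 𝒢.composable → ℝ) :
    ∃ D₁ D₂, 𝒢.IsPartialDifferentials L D₁ D₂ := by
  let d : G × G → (E × E →L[ℝ] ℝ) := fun p =>
    mfderivWithin (𝓘(ℝ, E).prod 𝓘(ℝ, E)) 𝓘(ℝ, ℝ) (𝒢.extendZero L) 𝒢.composable p
  refine ⟨fun g h => (d (g, h)).comp (ContinuousLinearMap.inl ℝ E E),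
    fun g h => (d (g, h)).comp (ContinuousLinearMap.inr ℝ E E), fun p w => ?_⟩
  have : 𝒢.differential L p w = d p.1 (w.1.1, w.1.2) := rfl
  rw [this]
  simp [← map_add]

/-! ### The prolongation `P^α G` and its cotangent groupoid -/

/-- The prolongation `P^α G` of `G` over its source map, a groupoid over `G`. -/
def Prolongation : Type _ :=
  {p : G × G × G // 𝒢.src p.1 = 𝒢.src p.2.1 ∧ 𝒢.tgt p.2.1 = 𝒢.src p.2.2}

/-- The source map `(g, h, r) ↦ g` of `P^α G`. -/
def Prolongation.source {𝒢 : LieGroupoid E F G Q} (p : 𝒢.Prolongation) : G := p.1.1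

/-- The target map `(g, h, r) ↦ r` of `P^α G`. -/
def Prolongation.target {𝒢 : LieGroupoid E F G Q} (p : 𝒢.Prolongation) : G := p.1.2.2

/-- The tangent space `T_{(g,h,r)} (P^α G) = {(u, v, w) | Tα u = Tα v, Tβ v = Tα w}`. -/
def tangentProlongation (p : 𝒢.Prolongation) : Submodule ℝ (E × E × E) where
  carrier := {w | 𝒢.dsrc p.1.1 w.1 = 𝒢.dsrc p.1.2.1 w.2.1 ∧
    𝒢.dtgt p.1.2.1 w.2.1 = 𝒢.dsrc p.1.2.2 w.2.2}
  add_mem' := by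
    rintro a b ⟨ha, ha'⟩ ⟨hb, hb'⟩
    simp only [mem_ofPred_eq, Prod.fst_add, Prod.snd_add, map_add]
    rw [ha, hb, ha', hb']
    exact ⟨rfl, rfl⟩
  zero_mem' := by simp
  smul_mem' := by
    rintro c a ⟨ha, ha'⟩
    simp only [mem_ofPred_eq, Prod.smul_fst, Prod.smul_snd, map_smul]
    rw [ha, ha']
    exact ⟨rfl, rfl⟩

/-- The inclusion `i_{G₂} : G₂ → P^α G`, `(g, h) ↦ (g, g, h)`. -/
def inclusion (p : 𝒢.composable) : 𝒢.Prolongation := ⟨(p.1.1, p.1.1, p.1.2), rfl, p.2⟩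

/-- The tangent map `(u, v) ↦ (u, u, v)` of the inclusion `i_{G₂}`. -/
def dInclusion (p : 𝒢.composable) :
    𝒢.tangentComposable p →ₗ[ℝ] 𝒢.tangentProlongation (𝒢.inclusion p) where
  toFun w := ⟨(w.1.1, w.1.1, w.1.2), rfl, w.2⟩
  map_add' _ _ := rfl
  map_smul' _ _ := rfl

/-- The fibre `A_g (P^α G) = {(a, Y) ∈ A_{α(g)} G × T_g G | Tα Y = Tβ a}` of the Lie algebroid of
`P^α G`. -/
def algebroidProlongation (g : G) : Submodule ℝ (E × E) where
  carrier := {z | z.1 ∈ 𝒢.algebroid (𝒢.src g) ∧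
    𝒢.dsrc g z.2 = 𝒢.dtgt (𝒢.one (𝒢.src g)) z.1}
  add_mem' := by
    rintro a b ⟨ha, ha'⟩ ⟨hb, hb'⟩
    refine ⟨Submodule.add_mem _ ha hb, ?_⟩
    simp only [Prod.fst_add, Prod.snd_add, map_add]
    rw [ha', hb']
  zero_mem' := by simp
  smul_mem' := by
    rintro c a ⟨ha, ha'⟩
    refine ⟨Submodule.smul_mem _ c ha, ?_⟩
    simp only [Prod.smul_fst, Prod.smul_snd, map_smul]
    rw [ha']

/-- The cotangent bundle `T*(P^α G)`. -/
abbrev CotangentProlongation : Type _ :=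
  Σ p : 𝒢.Prolongation, Module.Dual ℝ (𝒢.tangentProlongation p)

/-- The dual bundle `A*(P^α G)` over `G`. -/
abbrev DualAlgebroidProlongation : Type _ :=
  Σ g : G, Module.Dual ℝ (𝒢.algebroidProlongation g)

/-- `Σ_L = {μ ∈ T*(P^α G) | i_{G₂}^* μ = dL}`. -/
def lagrangianSubmanifold (L : 𝒢.composable → ℝ) : Set 𝒢.CotangentProlongation :=
  {x | ∃ (p : 𝒢.composable) (μ : Module.Dual ℝ (𝒢.tangentProlongation (𝒢.inclusion p))),
    x = ⟨𝒢.inclusion p, μ⟩ ∧ μ ∘ₗ 𝒢.dInclusion p = 𝒢.differential L p}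

theorem inv_one (q : Q) : 𝒢.inv (𝒢.one q) = 𝒢.one q := by
  have h := 𝒢.one_mul (𝒢.inv (𝒢.one q))
  have h' := 𝒢.mul_inv (𝒢.one q)
  rw [𝒢.src_inv, 𝒢.tgt_one] at h
  rw [𝒢.src_one] at h'
  exact h.symm.trans h'

/-- `T(ℓ_g)` is an honest derivative. -/
theorem hasMFDerivWithinAt_dLeft (g : G) :
    HasMFDerivWithinAt 𝓘(ℝ, E) 𝓘(ℝ, E) (fun x => 𝒢.mul g x) {x | 𝒢.src x = 𝒢.tgt g}
      (𝒢.one (𝒢.tgt g)) (𝒢.dLeft g) := by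
  have h1 : ContMDiffWithinAt 𝓘(ℝ, E) (𝓘(ℝ, E).prod 𝓘(ℝ, E)) ∞ (fun x : G => (g, x))
      {x | 𝒢.src x = 𝒢.tgt g} (𝒢.one (𝒢.tgt g)) :=
    contMDiffWithinAt_const.prodMk contMDiffWithinAt_id
  have h2 := (𝒢.smooth_mul (g, 𝒢.one (𝒢.tgt g)) (𝒢.src_one _).symm).comp
    (𝒢.one (𝒢.tgt g)) h1 (fun x hx => Eq.symm hx)
  exact (h2.mdifferentiableWithinAt (by simp)).hasMFDerivWithinAt

/-- `T(r_g ∘ i)` is an honest derivative. -/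
theorem hasMFDerivWithinAt_dRightInv (g : G) :
    HasMFDerivWithinAt 𝓘(ℝ, E) 𝓘(ℝ, E) (fun x => 𝒢.mul (𝒢.inv x) g) {x | 𝒢.src x = 𝒢.src g}
      (𝒢.one (𝒢.src g)) (𝒢.dRightInv g) := by
  have h1 : ContMDiffWithinAt 𝓘(ℝ, E) (𝓘(ℝ, E).prod 𝓘(ℝ, E)) ∞ (fun x : G => (𝒢.inv x, g))
      {x | 𝒢.src x = 𝒢.src g} (𝒢.one (𝒢.src g)) :=
    (𝒢.smooth_inv _).contMDiffWithinAt.prodMk contMDiffWithinAt_const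
  have h2 := (𝒢.smooth_mul (𝒢.inv (𝒢.one (𝒢.src g)), g)
    (by rw [mem_ofPred_eq, 𝒢.tgt_inv, 𝒢.src_one])).comp
    (𝒢.one (𝒢.src g)) h1 (fun x hx => (𝒢.tgt_inv x).trans hx)
  exact (h2.mdifferentiableWithinAt (by simp)).hasMFDerivWithinAt

theorem hasMFDerivAt_src (g : G) : HasMFDerivAt 𝓘(ℝ, E) 𝓘(ℝ, F) 𝒢.src g (𝒢.dsrc g) :=
  ((𝒢.smooth_src g).mdifferentiableAt (by simp)).hasMFDerivAt

theorem hasMFDerivAt_tgt (g : G) : HasMFDerivAt 𝓘(ℝ, E) 𝓘(ℝ, F) 𝒢.tgt g (𝒢.dtgt g) :=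
  ((𝒢.smooth_tgt g).mdifferentiableAt (by simp)).hasMFDerivAt

section Translations

variable [FiniteDimensional ℝ E] [FiniteDimensional ℝ F] [IsManifold 𝓘(ℝ, E) ∞ G]
  [IsManifold 𝓘(ℝ, F) ∞ Q]

/-- Every derivative of `L` within `G₂` restricts to `dL` on the tangent space of `G₂`. -/
theorem differential_eq_of_hasMFDerivWithinAt {L : 𝒢.composable → ℝ} (hL : 𝒢.IsSmooth L)
    (p : 𝒢.composable) {ℓ : E × E →L[ℝ] ℝ}
    (hℓ : HasMFDerivWithinAt (𝓘(ℝ, E).prod 𝓘(ℝ, E)) 𝓘(ℝ, ℝ) (𝒢.extendZero L) 𝒢.composable p.1 ℓ)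
    (w : 𝒢.tangentComposable p) : 𝒢.differential L p w = ℓ w.1 := by
  have h1 : HasMFDerivAt (𝓘(ℝ, E).prod 𝓘(ℝ, E)) 𝓘(ℝ, F) (fun q : G × G => 𝒢.tgt q.1) p.1
      ((𝒢.dtgt p.1.1).comp (ContinuousLinearMap.fst ℝ E E)) :=
    HasMFDerivAt.comp p.1 ((𝒢.smooth_tgt p.1.1).mdifferentiableAt (by simp)).hasMFDerivAt
      (hasMFDerivAt_fst p.1)
  have h2 : HasMFDerivAt (𝓘(ℝ, E).prod 𝓘(ℝ, E)) 𝓘(ℝ, F) (fun q : G × G => 𝒢.src q.2) p.1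
      ((𝒢.dsrc p.1.2).comp (ContinuousLinearMap.snd ℝ E E)) :=
    HasMFDerivAt.comp p.1 ((𝒢.smooth_src p.1.2).mdifferentiableAt (by simp)).hasMFDerivAt
      (hasMFDerivAt_snd p.1)
  have hd := ((hL p.1 p.2).mdifferentiableWithinAt (by simp)).hasMFDerivWithinAt
  refine hasMFDerivWithinAt_unique_equalizer (Φ := fun q : G × G => 𝒢.tgt q.1)
    (Ψ := fun q : G × G => 𝒢.src q.2)
    ((𝒢.smooth_tgt.comp contMDiff_fst) p.1) ((𝒢.smooth_src.comp contMDiff_snd) p.1) p.2 h1 h2 ?_ hd hℓ ?_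
  · intro y
    obtain ⟨u, hu⟩ := 𝒢.submersion_tgt p.1.1 y
    refine ⟨((u, 0) : E × E), ?_⟩
    change 𝒢.dtgt p.1.1 u - 𝒢.dsrc p.1.2 0 = y
    rw [map_zero, sub_zero]
    exact hu
  · exact w.2

/-- Two derivatives within a fibre of `α` agree on `α`-vertical vectors. -/
theorem hasMFDerivWithinAt_unique_fibre {V W : Type*} [NormedAddCommGroup V] [NormedSpace ℝ V]
    [TopologicalSpace W] [ChartedSpace V W] {q : Q} {f : G → W} {f₁ f₂ : E →L[ℝ] V}
    (h₁ : HasMFDerivWithinAt 𝓘(ℝ, E) 𝓘(ℝ, V) f {x | 𝒢.src x = q} (𝒢.one q) f₁)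
    (h₂ : HasMFDerivWithinAt 𝓘(ℝ, E) 𝓘(ℝ, V) f {x | 𝒢.src x = q} (𝒢.one q) f₂)
    {a : E} (ha : a ∈ 𝒢.algebroid q) : f₁ a = f₂ a := by
  refine hasMFDerivWithinAt_unique_equalizer (Φ := 𝒢.src) (Ψ := fun _ => q)
    (𝒢.smooth_src _) contMDiffAt_const (𝒢.src_one q) (A := 𝒢.dsrc (𝒢.one q)) (B := 0)
    ((𝒢.smooth_src _).mdifferentiableAt (by simp)).hasMFDerivAt
    (hasMFDerivAt_const q (𝒢.one q)) ?_ h₁ h₂ ?_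
  · rw [sub_zero]
    exact 𝒢.submersion_src (𝒢.one q)
  · exact ha

/-- `Tα (Tℓ_g a) = 0`. -/
theorem dsrc_dLeft (g : G) {a : E} (ha : a ∈ 𝒢.algebroid (𝒢.tgt g)) :
    𝒢.dsrc g (𝒢.dLeft g a) = 0 := by
  have h0 : HasMFDerivAt 𝓘(ℝ, E) 𝓘(ℝ, F) 𝒢.src (𝒢.mul g (𝒢.one (𝒢.tgt g))) (𝒢.dsrc g) := by
    rw [𝒢.mul_one]; exact 𝒢.hasMFDerivAt_src g
  have h1 := HasMFDerivAt.comp_hasMFDerivWithinAt _ h0 (𝒢.hasMFDerivWithinAt_dLeft g)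
  have h2 : HasMFDerivWithinAt 𝓘(ℝ, E) 𝓘(ℝ, F) (𝒢.src ∘ fun x => 𝒢.mul g x)
      {x | 𝒢.src x = 𝒢.tgt g} (𝒢.one (𝒢.tgt g)) (0 : E →L[ℝ] F) :=
    (hasMFDerivWithinAt_const (𝒢.src g) _ _).congr_mono
      (fun x hx => 𝒢.src_mul g x (Eq.symm hx)) (𝒢.src_mul _ _ (𝒢.src_one _).symm) subset_rfl
  exact 𝒢.hasMFDerivWithinAt_unique_fibre h1 h2 ha

/-- `Tβ (Tℓ_g a) = Tβ a`. -/
theorem dtgt_dLeft (g : G) {a : E} (ha : a ∈ 𝒢.algebroid (𝒢.tgt g)) :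
    𝒢.dtgt g (𝒢.dLeft g a) = 𝒢.dtgt (𝒢.one (𝒢.tgt g)) a := by
  have h0 : HasMFDerivAt 𝓘(ℝ, E) 𝓘(ℝ, F) 𝒢.tgt (𝒢.mul g (𝒢.one (𝒢.tgt g))) (𝒢.dtgt g) := by
    rw [𝒢.mul_one]; exact 𝒢.hasMFDerivAt_tgt g
  have h1 := HasMFDerivAt.comp_hasMFDerivWithinAt _ h0 (𝒢.hasMFDerivWithinAt_dLeft g)
  have h2 : HasMFDerivWithinAt 𝓘(ℝ, E) 𝓘(ℝ, F) (𝒢.tgt ∘ fun x => 𝒢.mul g x)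
      {x | 𝒢.src x = 𝒢.tgt g} (𝒢.one (𝒢.tgt g)) (𝒢.dtgt (𝒢.one (𝒢.tgt g))) :=
    (𝒢.hasMFDerivAt_tgt _).hasMFDerivWithinAt.congr_mono
      (fun x hx => 𝒢.tgt_mul g x (Eq.symm hx)) (𝒢.tgt_mul _ _ (𝒢.src_one _).symm) subset_rfl
  exact 𝒢.hasMFDerivWithinAt_unique_fibre h1 h2 ha

/-- `Tα (T(r_g ∘ i) a) = Tβ a`. -/
theorem dsrc_dRightInv (g : G) {a : E} (ha : a ∈ 𝒢.algebroid (𝒢.src g)) :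
    𝒢.dsrc g (𝒢.dRightInv g a) = 𝒢.dtgt (𝒢.one (𝒢.src g)) a := by
  have h0 : HasMFDerivAt 𝓘(ℝ, E) 𝓘(ℝ, F) 𝒢.src ((fun x => 𝒢.mul (𝒢.inv x) g) (𝒢.one (𝒢.src g)))
      (𝒢.dsrc g) := by
    beta_reduce; rw [𝒢.inv_one, 𝒢.one_mul]; exact 𝒢.hasMFDerivAt_src g
  have h1 := HasMFDerivAt.comp_hasMFDerivWithinAt (𝒢.one (𝒢.src g)) h0
    (𝒢.hasMFDerivWithinAt_dRightInv g)
  have h2 : HasMFDerivWithinAt 𝓘(ℝ, E) 𝓘(ℝ, F) (𝒢.src ∘ fun x => 𝒢.mul (𝒢.inv x) g)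
      {x | 𝒢.src x = 𝒢.src g} (𝒢.one (𝒢.src g)) (𝒢.dtgt (𝒢.one (𝒢.src g))) := by
    have h3 : ∀ x, 𝒢.src x = 𝒢.src g → 𝒢.src (𝒢.mul (𝒢.inv x) g) = 𝒢.tgt x := fun x hx =>
      (𝒢.src_mul _ _ ((𝒢.tgt_inv x).trans hx)).trans (𝒢.src_inv x)
    exact (𝒢.hasMFDerivAt_tgt _).hasMFDerivWithinAt.congr_mono
      (fun x hx => h3 x hx) (h3 _ (𝒢.src_one _)) subset_rfl
  exact 𝒢.hasMFDerivWithinAt_unique_fibre h1 h2 ha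

/-- `Tβ (T(r_g ∘ i) a) = 0`. -/
theorem dtgt_dRightInv (g : G) {a : E} (ha : a ∈ 𝒢.algebroid (𝒢.src g)) :
    𝒢.dtgt g (𝒢.dRightInv g a) = 0 := by
  have h0 : HasMFDerivAt 𝓘(ℝ, E) 𝓘(ℝ, F) 𝒢.tgt ((fun x => 𝒢.mul (𝒢.inv x) g) (𝒢.one (𝒢.src g)))
      (𝒢.dtgt g) := by
    beta_reduce; rw [𝒢.inv_one, 𝒢.one_mul]; exact 𝒢.hasMFDerivAt_tgt g
  have h1 := HasMFDerivAt.comp_hasMFDerivWithinAt (𝒢.one (𝒢.src g)) h0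
    (𝒢.hasMFDerivWithinAt_dRightInv g)
  have h2 : HasMFDerivWithinAt 𝓘(ℝ, E) 𝓘(ℝ, F) (𝒢.tgt ∘ fun x => 𝒢.mul (𝒢.inv x) g)
      {x | 𝒢.src x = 𝒢.src g} (𝒢.one (𝒢.src g)) (0 : E →L[ℝ] F) := by
    have h3 : ∀ x, 𝒢.src x = 𝒢.src g → 𝒢.tgt (𝒢.mul (𝒢.inv x) g) = 𝒢.tgt g := fun x hx =>
      𝒢.tgt_mul _ _ ((𝒢.tgt_inv x).trans hx)
    exact (hasMFDerivWithinAt_const (𝒢.tgt g) _ _).congr_mono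
      (fun x hx => h3 x hx) (h3 _ (𝒢.src_one _)) subset_rfl
  exact 𝒢.hasMFDerivWithinAt_unique_fibre h1 h2 ha

/-- The value at `(g, h, r)` of the left-invariant vector field on `P^α G` defined by an element
`(a, Y)` of `A_r (P^α G)`: `(0, Tℓ_h a, Y)`. -/
def leftInvariant (p : 𝒢.Prolongation) :
    𝒢.algebroidProlongation p.target →ₗ[ℝ] 𝒢.tangentProlongation p where
  toFun z := ⟨(0, 𝒢.dLeft p.1.2.1 z.1.1, z.1.2), by
    have ha : z.1.1 ∈ 𝒢.algebroid (𝒢.tgt p.1.2.1) := by rw [p.2.2]; exact z.2.1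
    refine ⟨?_, ?_⟩
    · change 𝒢.dsrc p.1.1 0 = 𝒢.dsrc p.1.2.1 (𝒢.dLeft p.1.2.1 z.1.1)
      rw [𝒢.dsrc_dLeft _ ha, map_zero]
    · change 𝒢.dtgt p.1.2.1 (𝒢.dLeft p.1.2.1 z.1.1) = 𝒢.dsrc p.1.2.2 z.1.2
      rw [𝒢.dtgt_dLeft _ ha, p.2.2]
      exact z.2.2.symm⟩
  map_add' z z' := by
    apply Subtype.ext
    simp
  map_smul' c z := by
    apply Subtype.ext
    simp

/-- The value at `(g, h, r)` of the right-invariant vector field on `P^α G` defined by an element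
`(a, Y)` of `A_g (P^α G)`: `(-Y, -T(r_h ∘ i) a, 0)`. -/
def rightInvariant (p : 𝒢.Prolongation) :
    𝒢.algebroidProlongation p.source →ₗ[ℝ] 𝒢.tangentProlongation p where
  toFun z := ⟨(-z.1.2, -𝒢.dRightInv p.1.2.1 z.1.1, 0), by
    have ha : z.1.1 ∈ 𝒢.algebroid (𝒢.src p.1.2.1) := by rw [← p.2.1]; exact z.2.1
    refine ⟨?_, ?_⟩
    · change 𝒢.dsrc p.1.1 (-z.1.2) = 𝒢.dsrc p.1.2.1 (-𝒢.dRightInv p.1.2.1 z.1.1)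
      rw [map_neg, map_neg, 𝒢.dsrc_dRightInv _ ha, ← p.2.1]
      exact congrArg _ z.2.2
    · change 𝒢.dtgt p.1.2.1 (-𝒢.dRightInv p.1.2.1 z.1.1) = 𝒢.dsrc p.1.2.2 0
      rw [map_neg, 𝒢.dtgt_dRightInv _ ha, map_zero, neg_zero]⟩
  map_add' z z' := by
    refine Subtype.ext (Prod.ext (neg_add _ _) (Prod.ext ?_ (add_zero 0).symm))
    change -𝒢.dRightInv p.1.2.1 (z.1.1 + z'.1.1) =
      -𝒢.dRightInv p.1.2.1 z.1.1 + -𝒢.dRightInv p.1.2.1 z'.1.1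
    rw [map_add, neg_add]
  map_smul' c z := by
    refine Subtype.ext (Prod.ext (smul_neg _ _).symm (Prod.ext ?_ (smul_zero c).symm))
    change -𝒢.dRightInv p.1.2.1 (c • z.1.1) = c • -𝒢.dRightInv p.1.2.1 z.1.1
    rw [map_smul, smul_neg]

/-- The source map `α̃ : T*(P^α G) → A*(P^α G)` of the cotangent groupoid:
`⟨α̃(μ), Z⟩ = ⟨μ, right-invariant field of Z⟩`. -/
def cotangentSource (x : 𝒢.CotangentProlongation) : 𝒢.DualAlgebroidProlongation :=
  ⟨x.1.source, x.2 ∘ₗ 𝒢.rightInvariant x.1⟩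

/-- The target map `β̃ : T*(P^α G) → A*(P^α G)` of the cotangent groupoid:
`⟨β̃(μ), Z⟩ = ⟨μ, left-invariant field of Z⟩`. -/
def cotangentTarget (x : 𝒢.CotangentProlongation) : 𝒢.DualAlgebroidProlongation :=
  ⟨x.1.target, x.2 ∘ₗ 𝒢.leftInvariant x.1⟩

/-- The sequence `γ₁, …, γ_{N-1}` in `T*(P^α G)` satisfies the discrete second-order dynamics on
`Σ_L`: it lies in `Σ_L`, and successive elements are composable in the cotangent groupoid. -/
def SatisfiesDynamics (L : 𝒢.composable → ℝ) (N : ℕ) (γ : ℕ → 𝒢.CotangentProlongation) : Prop :=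
  (∀ k, 1 ≤ k → k + 1 ≤ N → γ k ∈ 𝒢.lagrangianSubmanifold L) ∧
    ∀ k, 2 ≤ k → k + 1 ≤ N → 𝒢.cotangentSource (γ k) = 𝒢.cotangentTarget (γ (k - 1))

end Translations

/-- The discrete second-order Euler–Lagrange equations for `g₁, …, g_N`, for a given choice of
partial differentials `D₁` and `D₂` of the Lagrangian: for `k = 2, …, N - 2`,
`ℓ_{g_k}^* (D₁L(g_k, g_{k+1}) + D₂L(g_{k-1}, g_k))
  + (r_{g_{k+1}} ∘ i)^* (D₁L(g_{k+1}, g_{k+2}) + D₂L(g_k, g_{k+1})) = 0` on `A_{β(g_k)} G`. -/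
def SatisfiesEulerLagrange (D₁ D₂ : G → G → (E →L[ℝ] ℝ)) (N : ℕ) (g : ℕ → G) : Prop :=
  ∀ k, 2 ≤ k → k + 2 ≤ N → ∀ a ∈ 𝒢.algebroid (𝒢.tgt (g k)),
    (D₁ (g k) (g (k + 1)) + D₂ (g (k - 1)) (g k)) (𝒢.dLeft (g k) a) +
      (D₁ (g (k + 1)) (g (k + 2)) + D₂ (g k) (g (k + 1))) (𝒢.dRightInv (g (k + 1)) a) = 0

end LieGroupoid

end SecondOrderGroupoid

end

/-! A tangent vector at `(g, g, h)` splits as `(u, v, w) = (v, v, w) + (u - v, 0, 0)`, the first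
summand being tangent to `i_{G₂}(G₂)` and the second having an `α`-vertical entry. So a covector in
`Σ_L` over `(g, g, h)` amounts to a free functional `ν` on `ker T_g α`, the rest being fixed by `dL`
(`exists_eq_covector`, `covector_comp_dInclusion`).

Let `ν` and `ν'` belong to covectors over `(g, g, h)` and `(h, h, r)`. The fibre `A_h(P^α G)` is
spanned by the pairs `(0, z)`, with `z` vertical, and `(a, T(r_h ∘ i) a)`. Testing composability on
these gives two conditions (`cotangentSource_eq_cotangentTarget_iff`): `ν' = -D₂L(g, h)` on vertical
vectors, and an equation for `ν ∘ Tℓ_g`. Along a sequence, the first condition determines `ν_k` on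
vertical vectors for `k ≥ 2`. As `Tℓ_{g_k} a` is vertical, substituting this into the second
condition for `γ_k` and `γ_{k+1}` gives exactly the Euler–Lagrange equation at `k`.

Only `ν_1` has no predecessor to fix it. The second condition for `γ_1` and `γ_2` is therefore no
constraint on the `g_k`: it can be solved for `ν_1`, because `Tℓ_{g_1}` is injective on the
algebroid (`exists_leftInverse_dLeft`, `exists_comp_dLeft_eq`). -/

namespace SecondOrderGroupoid

namespace LieGroupoid

/-! ### Covectors on the prolongation that pull back to the differential of the Lagrangian -/

variable {E F : Type*} [NormedAddCommGroup E] [NormedSpace ℝ E]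
  [NormedAddCommGroup F] [NormedSpace ℝ F]
  {G Q : Type*} [TopologicalSpace G] [ChartedSpace E G]
  [TopologicalSpace Q] [ChartedSpace F Q]
  (𝒢 : LieGroupoid E F G Q)

/-- The covector `(u, v, w) ↦ D₁ v + D₂ w + ν (u - v)` at the point `(g, g, h)` of `P^α G`. -/
def covector (p : 𝒢.composable) (D₁ D₂ : E →L[ℝ] ℝ) (ν : Module.Dual ℝ E) :
    Module.Dual ℝ (𝒢.tangentProlongation (𝒢.inclusion p)) where
  toFun w := D₁ w.1.2.1 + D₂ w.1.2.2 + ν (w.1.1 - w.1.2.1)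
  map_add' a b := by
    simp only [Submodule.coe_add, Prod.fst_add, Prod.snd_add, map_add, map_sub]
    ring
  map_smul' c a := by
    simp only [Submodule.coe_smul, Prod.smul_fst, Prod.smul_snd, map_smul, map_sub, smul_eq_mul,
      RingHom.id_apply]
    ring

/-- The image of `dInclusion` has equal first two entries, which kills the `ν` term; hence `ν` may
be chosen freely within `Σ_L`. -/
theorem covector_comp_dInclusion {L : 𝒢.composable → ℝ} {D₁ D₂ : G → G → (E →L[ℝ] ℝ)}
    (hD : 𝒢.IsPartialDifferentials L D₁ D₂) (p : 𝒢.composable) (ν : Module.Dual ℝ E) :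
    𝒢.covector p (D₁ p.1.1 p.1.2) (D₂ p.1.1 p.1.2) ν ∘ₗ 𝒢.dInclusion p = 𝒢.differential L p := by
  ext w
  rw [hD p w]
  change D₁ p.1.1 p.1.2 w.1.1 + D₂ p.1.1 p.1.2 w.1.2 + ν (w.1.1 - w.1.1) = _
  simp

/-- Every covector that pulls back to `dL` along `i_{G₂}` is of the form `covector`. -/
theorem exists_eq_covector {L : 𝒢.composable → ℝ} {D₁ D₂ : G → G → (E →L[ℝ] ℝ)}
    (hD : 𝒢.IsPartialDifferentials L D₁ D₂) (p : 𝒢.composable)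
    {μ : Module.Dual ℝ (𝒢.tangentProlongation (𝒢.inclusion p))}
    (hμ : μ ∘ₗ 𝒢.dInclusion p = 𝒢.differential L p) :
    ∃ ν : Module.Dual ℝ E, μ = 𝒢.covector p (D₁ p.1.1 p.1.2) (D₂ p.1.1 p.1.2) ν := by
  let K : Submodule ℝ E := LinearMap.ker (𝒢.dsrc p.1.1).toLinearMap
  let j : K →ₗ[ℝ] 𝒢.tangentProlongation (𝒢.inclusion p) :=
    { toFun := fun z => ⟨(z.1, 0, 0), by
        refine ⟨?_, ?_⟩
        · change 𝒢.dsrc p.1.1 z.1 = 𝒢.dsrc p.1.1 0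
          rw [map_zero]
          exact z.2
        · change 𝒢.dtgt p.1.1 0 = 𝒢.dsrc p.1.2 0
          rw [map_zero, map_zero]⟩
      map_add' := fun a b => Subtype.ext (by simp)
      map_smul' := fun c a => Subtype.ext (by simp) }
  -- Only the values of `ν` on `K` are determined by `μ`; an arbitrary linear extension to all of
  -- `E` avoids functionals on varying subspaces.
  obtain ⟨ν, hν⟩ := LinearMap.exists_extend (μ ∘ₗ j)
  refine ⟨ν, LinearMap.ext fun w => ?_⟩
  have hz : w.1.1 - w.1.2.1 ∈ K := by
    change 𝒢.dsrc p.1.1 (w.1.1 - w.1.2.1) = 0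
    rw [map_sub, sub_eq_zero]
    exact w.2.1
  let t : 𝒢.tangentComposable p := ⟨(w.1.2.1, w.1.2.2), w.2.2⟩
  have hw : w = 𝒢.dInclusion p t + j ⟨_, hz⟩ := by
    refine Subtype.ext (Prod.ext ?_ (Prod.ext ?_ ?_))
    · exact (add_sub_cancel w.1.2.1 w.1.1).symm
    · exact (add_zero w.1.2.1).symm
    · exact (add_zero w.1.2.2).symm
  have h1 : μ (𝒢.dInclusion p t) = D₁ p.1.1 p.1.2 w.1.2.1 + D₂ p.1.1 p.1.2 w.1.2.2 :=
    (LinearMap.congr_fun hμ t).trans (hD p t)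
  have h2 : ν (w.1.1 - w.1.2.1) = μ (j ⟨_, hz⟩) := LinearMap.congr_fun hν ⟨_, hz⟩
  change μ w = D₁ p.1.1 p.1.2 w.1.2.1 + D₂ p.1.1 p.1.2 w.1.2.2 + ν (w.1.1 - w.1.2.1)
  rw [h2, ← h1, ← map_add, ← hw]

/-! ### Left translation and composability in the cotangent groupoid -/

variable [FiniteDimensional ℝ E] [FiniteDimensional ℝ F] [IsManifold 𝓘(ℝ, E) ∞ G]
  [IsManifold 𝓘(ℝ, F) ∞ Q]

/-- The tangent map of left translation by `g` has a left inverse, the tangent map of left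
translation by `g⁻¹`. -/
theorem exists_leftInverse_dLeft (g : G) :
    ∃ B : E →L[ℝ] E, ∀ a ∈ 𝒢.algebroid (𝒢.tgt g), B (𝒢.dLeft g a) = a := by
  have h1 : ContMDiffWithinAt 𝓘(ℝ, E) (𝓘(ℝ, E).prod 𝓘(ℝ, E)) ∞ (fun x : G => (𝒢.inv g, x))
      {x | 𝒢.src x = 𝒢.src g} g :=
    contMDiffWithinAt_const.prodMk contMDiffWithinAt_id
  have h2 := (𝒢.smooth_mul (𝒢.inv g, g) (𝒢.tgt_inv g)).comp g h1
    (fun x hx => (𝒢.tgt_inv g).trans (Eq.symm hx))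
  have h3 := (h2.mdifferentiableWithinAt (by simp)).hasMFDerivWithinAt
  set B := mfderivWithin 𝓘(ℝ, E) 𝓘(ℝ, E)
    ((fun p : G × G => 𝒢.mul p.1 p.2) ∘ fun x : G => (𝒢.inv g, x)) {x | 𝒢.src x = 𝒢.src g} g
  have h4 : HasMFDerivWithinAt 𝓘(ℝ, E) 𝓘(ℝ, E) (fun x : G => 𝒢.mul (𝒢.inv g) x)
      {x | 𝒢.src x = 𝒢.src g} ((fun x => 𝒢.mul g x) (𝒢.one (𝒢.tgt g))) (B : E →L[ℝ] E) := by
    beta_reduce; rw [𝒢.mul_one]; exact h3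
  have h5 := HasMFDerivWithinAt.comp (𝒢.one (𝒢.tgt g)) h4 (𝒢.hasMFDerivWithinAt_dLeft g)
    (fun x hx => 𝒢.src_mul g x (Eq.symm hx))
  -- The composite is the identity on the `α`-fibre only, so its derivative is compared with `id` on
  -- vertical vectors by uniqueness within the fibre.
  have h6 : ∀ x, 𝒢.src x = 𝒢.tgt g → 𝒢.mul (𝒢.inv g) (𝒢.mul g x) = x := fun x hx => by
    rw [← 𝒢.mul_assoc _ _ _ (𝒢.tgt_inv g) hx.symm, 𝒢.inv_mul, ← hx, 𝒢.one_mul]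
  have h7 : HasMFDerivWithinAt 𝓘(ℝ, E) 𝓘(ℝ, E)
      ((fun x : G => 𝒢.mul (𝒢.inv g) x) ∘ fun x => 𝒢.mul g x)
      {x | 𝒢.src x = 𝒢.tgt g} (𝒢.one (𝒢.tgt g)) (ContinuousLinearMap.id ℝ E) :=
    (hasMFDerivAt_id (𝒢.one (𝒢.tgt g))).hasMFDerivWithinAt.congr_mono
      (fun x hx => h6 x hx) (h6 _ (𝒢.src_one _)) subset_rfl
  exact ⟨B, fun a ha => 𝒢.hasMFDerivWithinAt_unique_fibre h5 h7 ha⟩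

/-- Composability in the cotangent groupoid of two covectors over `(g, g, h)` and `(h, h, r)`. -/
theorem cotangentSource_eq_cotangentTarget_iff {g h r : G} (hgh : 𝒢.tgt g = 𝒢.src h)
    (hhr : 𝒢.tgt h = 𝒢.src r) (D₁ D₂ D₁' D₂' : E →L[ℝ] ℝ) (ν ν' : Module.Dual ℝ E) :
    𝒢.cotangentSource ⟨𝒢.inclusion ⟨(h, r), hhr⟩, 𝒢.covector ⟨(h, r), hhr⟩ D₁' D₂' ν'⟩ =
        𝒢.cotangentTarget ⟨𝒢.inclusion ⟨(g, h), hgh⟩, 𝒢.covector ⟨(g, h), hgh⟩ D₁ D₂ ν⟩ ↔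
      (∀ z, 𝒢.dsrc h z = 0 → ν' z = -D₂ z) ∧
        ∀ a ∈ 𝒢.algebroid (𝒢.tgt g),
          (D₁ (𝒢.dLeft g a) - ν (𝒢.dLeft g a)) + (D₁' + D₂) (𝒢.dRightInv h a) = 0 := by
  have key : 𝒢.cotangentSource ⟨𝒢.inclusion ⟨(h, r), hhr⟩, 𝒢.covector ⟨(h, r), hhr⟩ D₁' D₂' ν'⟩ =
        𝒢.cotangentTarget ⟨𝒢.inclusion ⟨(g, h), hgh⟩, 𝒢.covector ⟨(g, h), hgh⟩ D₁ D₂ ν⟩ ↔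
      ∀ z : 𝒢.algebroidProlongation h,
        D₁' (-𝒢.dRightInv h z.1.1) + D₂' 0 + ν' (-z.1.2 - -𝒢.dRightInv h z.1.1) =
          D₁ (𝒢.dLeft g z.1.1) + D₂ z.1.2 + ν (0 - 𝒢.dLeft g z.1.1) := by
    -- Both base points are `h` by definition, so the heterogeneous equality is an ordinary equality
    -- of functionals on `A_h(P^α G)`.
    refine Sigma.mk.inj_iff.trans ?_
    constructor
    · rintro ⟨-, h2⟩ z
      exact LinearMap.congr_fun (eq_of_heq h2) z
    · exact fun h2 => ⟨rfl, heq_of_eq (LinearMap.ext h2)⟩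
  rw [key]
  constructor
  · intro H
    refine ⟨fun z hz => ?_, fun a ha => ?_⟩
    · have := H ⟨(0, z), Submodule.zero_mem _, by simpa using hz⟩
      simp only [map_zero, neg_zero, sub_zero, map_neg] at this
      linarith
    · rw [hgh] at ha
      -- This choice of `Y` makes the argument `-Y + T(r_h ∘ i) a` of `ν'` vanish.
      have := H ⟨(a, 𝒢.dRightInv h a), ha, 𝒢.dsrc_dRightInv h ha⟩
      simp only [map_zero, zero_sub, sub_self, map_neg] at this
      rw [add_apply]
      linarith
  · rintro ⟨H1, H2⟩ ⟨⟨a, Y⟩, ha, hY⟩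
    -- Here `(a, Y) = (a, T(r_h ∘ i) a) + (0, Y - T(r_h ∘ i) a)`, and the second entry of the last
    -- pair is vertical.
    have h1 := H1 (Y - 𝒢.dRightInv h a) (by
      rw [map_sub, 𝒢.dsrc_dRightInv h ha, sub_eq_zero]; exact hY)
    have h2 := H2 a (by rw [hgh]; exact ha)
    rw [add_apply] at h2
    simp only [map_sub, map_zero, map_neg] at h1 h2 ⊢
    linarith

/-- A linear functional on `A_{β(g)} G` is the pull-back of a covector by `ℓ_g`. -/
theorem exists_comp_dLeft_eq (g : G) (φ : Module.Dual ℝ E) :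
    ∃ ν : Module.Dual ℝ E, ∀ a ∈ 𝒢.algebroid (𝒢.tgt g), ν (𝒢.dLeft g a) = φ a := by
  obtain ⟨B, hB⟩ := 𝒢.exists_leftInverse_dLeft g
  refine ⟨φ ∘ₗ B.toLinearMap, fun a ha => ?_⟩
  change φ (B (𝒢.dLeft g a)) = φ a
  rw [hB a ha]

end LieGroupoid

end SecondOrderGroupoid

/-! ### The equivalence with the Euler–Lagrange equations -/

theorem mainTheorem3 {E F : Type*} [NormedAddCommGroup E] [NormedSpace ℝ E]
    [FiniteDimensional ℝ E] [NormedAddCommGroup F] [NormedSpace ℝ F] [FiniteDimensional ℝ F]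
    {G Q : Type*} [TopologicalSpace G] [ChartedSpace E G] [IsManifold 𝓘(ℝ, E) ∞ G]
    [TopologicalSpace Q] [ChartedSpace F Q] [IsManifold 𝓘(ℝ, F) ∞ Q]
    (𝒢 : SecondOrderGroupoid.LieGroupoid E F G Q) (L : 𝒢.composable → ℝ) (hL : 𝒢.IsSmooth L)
    (D₁ D₂ : G → G → (E →L[ℝ] ℝ)) (hD : 𝒢.IsPartialDifferentials L D₁ D₂)
    (N : ℕ) (g : ℕ → G) (hg : ∀ k, 1 ≤ k → k + 1 ≤ N → 𝒢.tgt (g k) = 𝒢.src (g (k + 1))) :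
    (∃ γ : ℕ → 𝒢.CotangentProlongation,
        (∀ k, 1 ≤ k → k + 1 ≤ N → (γ k).1.1 = (g k, g k, g (k + 1))) ∧
        𝒢.SatisfiesDynamics L N γ) ↔
      𝒢.SatisfiesEulerLagrange D₁ D₂ N g := by
  constructor
  · rintro ⟨γ, hγ, hmem, hcomp⟩
    have hν : ∀ k, ∀ h1 : 1 ≤ k, ∀ h2 : k + 1 ≤ N, ∃ ν : Module.Dual ℝ E,
        γ k = ⟨𝒢.inclusion ⟨(g k, g (k + 1)), hg k h1 h2⟩,
          𝒢.covector _ (D₁ (g k) (g (k + 1))) (D₂ (g k) (g (k + 1))) ν⟩ := by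
      intro k h1 h2
      obtain ⟨p, μ, hk, hμ⟩ := hmem k h1 h2
      have hp := hγ k h1 h2
      rw [hk] at hp
      obtain ⟨⟨x, y⟩, hxy⟩ := p
      obtain ⟨rfl, -, rfl⟩ : x = g k ∧ x = g k ∧ y = g (k + 1) := by
        simpa [SecondOrderGroupoid.LieGroupoid.inclusion] using hp
      obtain ⟨ν, hν⟩ := 𝒢.exists_eq_covector hD _ hμ
      exact ⟨ν, by rw [hk, hν]⟩
    intro k h1 h2 a ha
    obtain ⟨j, rfl⟩ : ∃ j, k = j + 1 := ⟨k - 1, by omega⟩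
    obtain ⟨ν₀, h₀⟩ := hν j (by omega) (by omega)
    obtain ⟨ν₁, h₁⟩ := hν (j + 1) (by omega) (by omega)
    obtain ⟨ν₂, h₂⟩ := hν (j + 2) (by omega) (by omega)
    have c₁ := hcomp (j + 1) (by omega) (by omega)
    have c₂ := hcomp (j + 2) (by omega) (by omega)
    rw [Nat.add_sub_cancel, h₀, h₁] at c₁
    change 𝒢.cotangentSource (γ (j + 2)) = 𝒢.cotangentTarget (γ (j + 1)) at c₂
    rw [h₁, h₂] at c₂
    -- Composability with the predecessor gives the value of `ν₁` on `Tℓ a`; composability with the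
    -- successor gives the equation that contains this value.
    have e₁ := ((𝒢.cotangentSource_eq_cotangentTarget_iff _ _ _ _ _ _ _ _).1 c₁).1
      _ (𝒢.dsrc_dLeft (g (j + 1)) ha)
    have e₂ := ((𝒢.cotangentSource_eq_cotangentTarget_iff _ _ _ _ _ _ _ _).1 c₂).2 a ha
    rw [e₁, sub_neg_eq_add] at e₂
    exact e₂
  · intro H
    -- The right-hand side is the second composability condition for `γ 1` and `γ 2`, solved for `ν₁
    -- ∘ Tℓ_{g_1}`.
    obtain ⟨ν₁, hν₁⟩ := 𝒢.exists_comp_dLeft_eq (g 1)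
      ((D₁ (g 1) (g 2)).toLinearMap ∘ₗ (𝒢.dLeft (g 1)).toLinearMap +
        (D₁ (g 2) (g 3) + D₂ (g 1) (g 2)).toLinearMap ∘ₗ (𝒢.dRightInv (g 2)).toLinearMap)
    let ν : ℕ → Module.Dual ℝ E := fun k =>
      if k = 1 then ν₁ else (-D₂ (g (k - 1)) (g k)).toLinearMap
    -- For `1 ≤ k ≤ N - 1` the pair is composable; the fallback, the zero covector over an identity
    -- pair, only makes `γ` total.
    let γ : ℕ → 𝒢.CotangentProlongation := fun k =>
      open Classical in
      if h : 𝒢.tgt (g k) = 𝒢.src (g (k + 1)) then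
        ⟨𝒢.inclusion ⟨(g k, g (k + 1)), h⟩,
          𝒢.covector _ (D₁ (g k) (g (k + 1))) (D₂ (g k) (g (k + 1))) (ν k)⟩
      else ⟨𝒢.inclusion ⟨(g k, 𝒢.one (𝒢.tgt (g k))), (𝒢.src_one _).symm⟩, 0⟩
    have hγ : ∀ k, ∀ h1 : 1 ≤ k, ∀ h2 : k + 1 ≤ N,
        γ k = ⟨𝒢.inclusion ⟨(g k, g (k + 1)), hg k h1 h2⟩,
          𝒢.covector _ (D₁ (g k) (g (k + 1))) (D₂ (g k) (g (k + 1))) (ν k)⟩ :=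
      fun k h1 h2 => dif_pos (hg k h1 h2)
    refine ⟨γ, fun k h1 h2 => by rw [hγ k h1 h2]; rfl, fun k h1 h2 => ?_, fun k h1 h2 => ?_⟩
    · exact ⟨⟨(g k, g (k + 1)), hg k h1 h2⟩, _, hγ k h1 h2,
        𝒢.covector_comp_dInclusion hD ⟨(g k, g (k + 1)), hg k h1 h2⟩ (ν k)⟩
    · obtain ⟨j, rfl⟩ : ∃ j, k = j + 1 := ⟨k - 1, by omega⟩
      rw [Nat.add_sub_cancel, hγ (j + 1) (by omega) h2, hγ j (by omega) (by omega)]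
      refine (𝒢.cotangentSource_eq_cotangentTarget_iff _ _ _ _ _ _ _ _).2
        ⟨fun z _ => ?_, fun a ha => ?_⟩
      · have : ν (j + 1) = (-D₂ (g j) (g (j + 1))).toLinearMap := if_neg (by omega)
        rw [this]
        rfl
      -- For `j = 1` the condition holds by the choice of `ν₁`; for `j ≥ 2` it is the Euler–Lagrange
      -- equation at `j`.
      · by_cases hj : j = 1
        · subst hj
          have h3 : ν 1 (𝒢.dLeft (g 1) a) = D₁ (g 1) (g 2) (𝒢.dLeft (g 1) a) +
            (D₁ (g 2) (g 3) + D₂ (g 1) (g 2)) (𝒢.dRightInv (g 2) a) := hν₁ a ha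
          rw [h3]
          ring
        · have h3 : ν j (𝒢.dLeft (g j) a) = -D₂ (g (j - 1)) (g j) (𝒢.dLeft (g j) a) := by
            have : ν j = (-D₂ (g (j - 1)) (g j)).toLinearMap := if_neg hj
            rw [this]
            rfl
          rw [h3, sub_neg_eq_add]
          exact H j (by omega) (by omega) a ha
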